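/- Let $B\in\mathbb R^{n\times n}$ be an irreducible nonnegative matrix with spectral radius $\rho(B)$ (irreducible: no permutation matrix $P$ makes $P^TBP$ block upper triangular with two nonempty square diagonal blocks), and let $0<\gamma<1$. For vectors $\mathbf w,\mathbf v$ write $\min(\mathbf v)=\min_i \mathbf v^{(i)}$, $\min(\mathbf w/\mathbf v)=\min_i \mathbf w^{(i)}/\mathbf v^{(i)}$, $\max(\mathbf w/\mathbf v)=\max_i \mathbf w^{(i)}/\mathbf v^{(i)}$, and let $\|\cdot\|$ be the Euclidean norm. Let the sequences $\{\mathbf x_k\}$, $\{\overline\lambda_k\}$ be generated by the inexact Noda iteration INI_1 with parameter $\gamma$: starting from an arbitrary vector $\mathbf x_0>\mathbf 0$ with $\|\mathbf x_0\|=1$ and $\overline\lambda_0=\max(B\mathbf x_0/\mathbf x_0)$, for $k=0,1,2,\dots$ a vector $\mathbf y_{k+1}$ is computed such that $$(\overline\lambda_k I-B)\,\mathbf y_{k+1}=\mathbf x_k+\mathbf f_k,\qquad \|\mathbf f_k\|\le\gamma\min(\mathbf x_k),$$ and then $$\mathbf x_{k+1}=\frac{\mathbf y_{k+1}}{\|\mathbf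 y_{k+1}\|},\qquad \overline\lambda_{k+1}=\overline\lambda_k-\min\Bigl(\frac{\mathbf x_k+\mathbf f_k}{\mathbf y_{k+1}}\Bigr);$$ if $B\mathbf x_k=\overline\lambda_k\mathbf x_k$ for some $k$, the iteration terminates and the sequences are continued by the constant values $\mathbf x_k,\overline\lambda_k$. Then $\{\overline\lambda_k\}$ is monotonically decreasing, with $\overline\lambda_{k+1}<\overline\lambda_k$ as long as $B\mathbf x_k\neq\overline\lambda_k\mathbf x_k$, and $\lim_{k\to\infty}\overline\lambda_k=\rho(B)$. -/

import Mathlib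

open Filter Topology Matrix

noncomputable section

namespace NodaIteration

variable {n : ℕ}

/-- `B` is reducible: for some permutation matrix `P`, the matrix `Pᵀ B P` (whose `(i, j)` entry
is `B (σ i) (σ j)`) is block upper triangular, with square diagonal blocks of sizes
`m ≥ 1` and `n - m ≥ 1`. -/
def IsReducible (B : Matrix (Fin n) (Fin n) ℝ) : Prop :=
  ∃ (σ : Equiv.Perm (Fin n)) (m : ℕ), 0 < m ∧ m < n ∧
    ∀ i j : Fin n, m ≤ (i : ℕ) → (j : ℕ) < m → B.submatrix σ σ i j = 0

/-- `B` is an irreducible nonnegative matrix. -/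
structure IsIrreducibleNonneg (B : Matrix (Fin n) (Fin n) ℝ) : Prop where
  nonneg : ∀ i j, 0 ≤ B i j
  irreducible : ¬ IsReducible B

/-- The spectral radius `ρ(B)`: the largest modulus of a complex eigenvalue of `B`. -/
def rho (B : Matrix (Fin n) (Fin n) ℝ) : ℝ :=
  (spectralRadius ℂ (B.map (fun t : ℝ => (t : ℂ)))).toReal

/-- `min(v)`, the smallest component of `v`. -/
def vmin (v : Fin n → ℝ) : ℝ := ⨅ i, v i

/-- `min(w / v)`, the smallest componentwise quotient. -/
def minRatio (w v : Fin n → ℝ) : ℝ := ⨅ i, w i / v i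

/-- `max(w / v)`, the largest componentwise quotient. -/
def maxRatio (w v : Fin n → ℝ) : ℝ := ⨆ i, w i / v i

/-- One step of the inexact Noda iteration INI_1 with parameter `γ`, from the current
approximate eigenvector and eigenvalue `(x, lam)` to the next pair `(x', lam')`. The vector `y`
is the approximate solution of the inner linear system, `f` is its residual vector,
and the norm is the Euclidean one. -/
def INI1Step (B : Matrix (Fin n) (Fin n) ℝ) (γ : ℝ)
    (x : EuclideanSpace ℝ (Fin n)) (lam : ℝ)
    (x' : EuclideanSpace ℝ (Fin n)) (lam' : ℝ) : Prop :=
  ∃ y f : EuclideanSpace ℝ (Fin n),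
    (lam • (1 : Matrix (Fin n) (Fin n) ℝ) - B) *ᵥ y.ofLp = x.ofLp + f.ofLp ∧
    ‖f‖ ≤ γ * vmin x.ofLp ∧
    x' = ‖y‖⁻¹ • y ∧
    lam' = lam - minRatio (x.ofLp + f.ofLp) y.ofLp

/-- `(x, lam)` is an exact eigenpair of `B`. -/
def IsExact (B : Matrix (Fin n) (Fin n) ℝ) (x : EuclideanSpace ℝ (Fin n)) (lam : ℝ) : Prop :=
  B *ᵥ x.ofLp = lam • x.ofLp

/-- The sequences `x k`, `lam k` are generated by INI_1 with parameter `γ`. The iteration starts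
from an arbitrary positive unit vector. When `(x k, lam k)` is an exact eigenpair the
inner system is singular and the iteration has terminated: the sequences are then continued by
their final values. -/
structure IsINI1 (B : Matrix (Fin n) (Fin n) ℝ) (γ : ℝ)
    (x : ℕ → EuclideanSpace ℝ (Fin n)) (lam : ℕ → ℝ) : Prop where
  pos_zero : ∀ i, 0 < x 0 i
  norm_zero : ‖x 0‖ = 1
  lam_zero : lam 0 = maxRatio (B *ᵥ (x 0).ofLp) (x 0).ofLp
  step : ∀ k, ¬ IsExact B (x k) (lam k) →
    INI1Step B γ (x k) (lam k) (x (k + 1)) (lam (k + 1))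
  terminated : ∀ k, IsExact B (x k) (lam k) → x (k + 1) = x k ∧ lam (k + 1) = lam k

end NodaIteration

end

/-!
The pairs `(x k, lam k)` keep the invariant `x k > 0`, `‖x k‖ = 1`, `B x ≤ lam x`: if `x` is a
positive supersolution, `lam x - B x ≥ 0`, then a minimum principle
(`pos_of_supersolution`) forces every solution `y` of `lam y - B y = g > 0` to be positive, and
`lam' = lam - min (g / y)` is by construction the least number with `B y ≤ lam' y`. In particular
`lam' < lam`, so `lam` decreases to some limit `L`.

Nonnegative unit vectors with `B v ≤ c v` form a compact set, all of whose elements are positive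
because `B` is irreducible (`pos_of_irreducible`). Hence the entries of all `x k` are at least some
`δ > 0` (`exists_uniform_pos`), and `lam k - lam (k + 1) = min (g / y) ≥ (1 - γ) δ / ‖y‖`. The left
side tends to `0`, so `‖y‖ → ∞`, and `(lam k - B) x (k + 1) = g / ‖y‖ → 0`. A limit point
of the `x k` is therefore a positive eigenvector of `B` for `L`, and a nonnegative
matrix has only its spectral radius as eigenvalue of a positive eigenvector
(`rho_eq_of_pos_eigenvector`).
-/

namespace NodaIteration

/-! ### Positive eigenvectors and the spectral radius -/

/-- A nonnegative matrix with a positive eigenvector `v` has no complex eigenvalue of modulus larger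
than the eigenvalue of `v`, as one sees at an index maximising `‖z i‖ / v i` for a complex
eigenvector `z`. -/
theorem rho_eq_of_pos_eigenvector {n : ℕ} [NeZero n] {B : Matrix (Fin n) (Fin n) ℝ}
    (hB : ∀ i j, 0 ≤ B i j) {v : Fin n → ℝ} (hv : ∀ i, 0 < v i) {L : ℝ}
    (h : B *ᵥ v = L • v) : rho B = L := by
  have hrow : ∀ i, ∑ j, B i j * v j = L * v i := fun i => congrFun h i
  have hL : 0 ≤ L := by
    have h0 := hrow 0
    have : 0 ≤ L * v 0 := h0 ▸ Finset.sum_nonneg fun j _ => mul_nonneg (hB _ _) (hv j).le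
    exact nonneg_of_mul_nonneg_left this (hv 0)
  set A : Matrix (Fin n) (Fin n) ℂ := B.map (fun t : ℝ => (t : ℂ)) with hA
  have hmem : (L : ℂ) ∈ spectrum ℂ A := by
    rw [← Matrix.spectrum_toLin']
    refine Module.End.HasEigenvalue.mem_spectrum
      (Module.End.hasEigenvalue_of_hasEigenvector (x := fun i => (v i : ℂ)) ⟨?_, ?_⟩)
    · rw [Module.End.mem_eigenspace_iff, Matrix.toLin'_apply]
      ext i
      simp only [Matrix.mulVec, dotProduct, hA, Matrix.map_apply, Pi.smul_apply, smul_eq_mul]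
      exact_mod_cast hrow i
    · intro h0
      have := congrFun h0 0
      simp only [Pi.zero_apply, Complex.ofReal_eq_zero] at this
      exact (hv 0).ne' this
  have hle : ∀ μ ∈ spectrum ℂ A, ‖μ‖ ≤ L := by
    intro μ hμ
    rw [← Matrix.spectrum_toLin', ← Module.End.hasEigenvalue_iff_mem_spectrum] at hμ
    obtain ⟨z, hz⟩ := hμ.exists_hasEigenvector
    have hz0 := hz.2
    have hzr : ∀ i, ∑ j, (B i j : ℂ) * z j = μ * z i := by
      intro i
      have := congrFun hz.apply_eq_smul i
      simpa [Matrix.toLin'_apply, Matrix.mulVec, dotProduct, hA] using this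
    obtain ⟨i, hi⟩ := Finite.exists_max fun i => ‖z i‖ / v i
    have hzj : ∀ j, ‖z j‖ ≤ ‖z i‖ / v i * v j := fun j => (div_le_iff₀ (hv j)).1 (hi j)
    have hzi : 0 < ‖z i‖ := by
      rw [norm_pos_iff]
      intro h0
      apply hz0
      ext j
      have := hzj j
      rw [h0] at this
      simpa using this
    have h1 : ‖μ‖ * ‖z i‖ ≤ L * ‖z i‖ := calc
      ‖μ‖ * ‖z i‖ = ‖∑ j, (B i j : ℂ) * z j‖ := by rw [hzr, norm_mul]
      _ ≤ ∑ j, B i j * (‖z i‖ / v i * v j) := by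
        refine (norm_sum_le _ _).trans (Finset.sum_le_sum fun j _ => ?_)
        rw [norm_mul, Complex.norm_real, Real.norm_of_nonneg (hB i j)]
        exact mul_le_mul_of_nonneg_left (hzj j) (hB i j)
      _ = ‖z i‖ / v i * ∑ j, B i j * v j := by
        rw [Finset.mul_sum]
        exact Finset.sum_congr rfl fun j _ => by ring
      _ = L * ‖z i‖ := by
        rw [hrow]
        have := (hv i).ne'
        field_simp
    exact le_of_mul_le_mul_right h1 hzi
  have hrad : spectralRadius ℂ A = ENNReal.ofReal L := by
    apply le_antisymm
    · refine iSup₂_le fun μ hμ => ?_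
      rw [← enorm_eq_nnnorm, ← ofReal_norm]
      exact ENNReal.ofReal_le_ofReal (hle μ hμ)
    · have h1 := le_iSup₂ (f := fun (μ : ℂ) (_ : μ ∈ spectrum ℂ A) => (‖μ‖₊ : ENNReal)) _ hmem
      rw [← enorm_eq_nnnorm, ← ofReal_norm, Complex.norm_real,
        Real.norm_of_nonneg hL] at h1
      exact h1
  rw [rho, ← hA, hrad, ENNReal.toReal_ofReal hL]

/-! ### Irreducibility and uniform positivity -/

/-- For irreducible `B ≥ 0`, a nonzero `v ≥ 0` with `B v ≤ c v` is positive: otherwise its support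
would be a block witnessing reducibility. -/
theorem pos_of_irreducible {n : ℕ} {B : Matrix (Fin n) (Fin n) ℝ} (hB : IsIrreducibleNonneg B)
    {v : Fin n → ℝ} {c : ℝ} (hv : ∀ i, 0 ≤ v i) (hv0 : v ≠ 0)
    (h : ∀ i, (B *ᵥ v) i ≤ c * v i) (i : Fin n) : 0 < v i := by
  by_contra hi
  have hi0 : v i = 0 := le_antisymm (not_lt.1 hi) (hv i)
  obtain ⟨k, hk⟩ := Function.ne_iff.1 hv0
  apply hB.irreducible
  have hlt : Fintype.card {j // v j ≠ 0} < n := by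
    have := Fintype.card_subtype_lt (p := fun j => v j ≠ 0) (x := i) (by simpa using hi0)
    simpa using this
  let e : {j : Fin n // (j : ℕ) < Fintype.card {j // v j ≠ 0}} ≃ {j // v j ≠ 0} :=
    Fintype.equivOfCardEq (by
      rw [Fintype.card_subtype, Fin.card_filter_val_lt, min_eq_right hlt.le])
  refine ⟨e.extendSubtype, Fintype.card {j // v j ≠ 0}, Fintype.card_pos_iff.2 ⟨⟨k, hk⟩⟩, hlt, ?_⟩
  intro a b ha hb
  have ha0 : v (e.extendSubtype a) = 0 := by
    simpa using e.extendSubtype_not_mem a (not_lt.2 ha)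
  have hb0 : v (e.extendSubtype b) ≠ 0 := e.extendSubtype_mem b hb
  have hsum := h (e.extendSubtype a)
  rw [ha0, mul_zero] at hsum
  have hterm : B (e.extendSubtype a) (e.extendSubtype b) * v (e.extendSubtype b) ≤ 0 :=
    (Finset.single_le_sum (f := fun j => B (e.extendSubtype a) j * v j)
      (fun j _ => mul_nonneg (hB.nonneg _ _) (hv j)) (Finset.mem_univ _)).trans hsum
  have := mul_eq_zero.1 (le_antisymm hterm (mul_nonneg (hB.nonneg _ _) (hv _)))
  exact this.resolve_right hb0

theorem isClosed_setOf_mulVec_le {n : ℕ} (B : Matrix (Fin n) (Fin n) ℝ) (c : ℝ) :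
    IsClosed {v : EuclideanSpace ℝ (Fin n) | ∀ i, (B *ᵥ v.ofLp) i ≤ c * v i} := by
  simp only [Set.ofPred_forall, Matrix.mulVec, dotProduct]
  exact isClosed_iInter fun i => isClosed_le (by fun_prop) (by fun_prop)

/-- The entries of the nonnegative unit vectors `v` with `B v ≤ c v` are bounded away from `0`. -/
theorem exists_uniform_pos {n : ℕ} [NeZero n] {B : Matrix (Fin n) (Fin n) ℝ}
    (hB : IsIrreducibleNonneg B) (c : ℝ) :
    ∃ δ > 0, ∀ v : EuclideanSpace ℝ (Fin n), ‖v‖ = 1 → (∀ i, 0 ≤ v i) →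
      (∀ i, (B *ᵥ v.ofLp) i ≤ c * v i) → ∀ i, δ ≤ v i := by
  let K : Set (EuclideanSpace ℝ (Fin n)) := Metric.sphere 0 1 ∩
    ({v | ∀ i, 0 ≤ v i} ∩ {v | ∀ i, (B *ᵥ v.ofLp) i ≤ c * v i})
  have hK : IsCompact K := by
    refine (isCompact_sphere _ _).inter_right (IsClosed.inter ?_ (isClosed_setOf_mulVec_le B c))
    simp only [Set.ofPred_forall]
    exact isClosed_iInter fun i => isClosed_le (by fun_prop) (by fun_prop)
  have hex : ∀ i, ∃ δ : ℝ, 0 < δ ∧ ∀ v ∈ K, δ ≤ v i := by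
    intro i
    refine hK.exists_forall_le' (f := fun v => v i) (by fun_prop) fun v hv => ?_
    refine pos_of_irreducible hB hv.2.1 ?_ hv.2.2 i
    intro h0
    have h1 : ‖v‖ = 1 := by simpa using hv.1
    have : v = 0 := by
      ext j
      exact congrFun h0 j
    simp [this] at h1
  choose δ hδ hle using hex
  obtain ⟨i, hi⟩ := Finite.exists_min δ
  exact ⟨δ i, hδ i, fun v h1 h2 h3 j => (hi j).trans (hle j v ⟨by simpa using h1, h2, h3⟩)⟩

/-! ### The minimum principle -/

/-- Minimum principle: if `B ≥ 0` and `lam - B` maps some positive vector `x` to a nonnegative one,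
then every `y` that it maps to a positive vector is positive. -/
theorem pos_of_supersolution {n : ℕ} [NeZero n] {B : Matrix (Fin n) (Fin n) ℝ}
    (hB : ∀ i j, 0 ≤ B i j) {lam : ℝ} {x y : Fin n → ℝ} (hx : ∀ i, 0 < x i)
    (hsup : ∀ i, (B *ᵥ x) i ≤ lam * x i) (hy : ∀ i, (B *ᵥ y) i < lam * y i) (i : Fin n) :
    0 < y i := by
  obtain ⟨m, hm⟩ := Finite.exists_min fun i => y i / x i
  set t := y m / x m with ht
  have hge : ∀ j, t * x j ≤ y j := fun j => (le_div_iff₀ (hx j)).1 (hm j)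
  have hmt : y m = t * x m := by
    rw [ht, div_mul_cancel₀ _ (hx m).ne']
  have htpos : 0 < t := by
    by_contra hneg
    have h1 : t * (B *ᵥ x) m ≤ (B *ᵥ y) m := by
      simp only [Matrix.mulVec, dotProduct, Finset.mul_sum]
      refine Finset.sum_le_sum fun j _ => ?_
      calc t * (B m j * x j) = B m j * (t * x j) := by ring
        _ ≤ B m j * y j := mul_le_mul_of_nonneg_left (hge j) (hB m j)
    have h2 := mul_le_mul_of_nonpos_left (hsup m) (not_lt.1 hneg)
    have h3 := hy m
    rw [hmt] at h3
    linarith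
  exact (mul_pos htpos (hx i)).trans_le (hge i)

/-! ### One step of the iteration -/

theorem vmin_le {n : ℕ} (v : Fin n → ℝ) (i : Fin n) : vmin v ≤ v i :=
  ciInf_le (Set.finite_range _).bddBelow i

theorem minRatio_le {n : ℕ} (w v : Fin n → ℝ) (i : Fin n) : minRatio w v ≤ w i / v i :=
  ciInf_le (Set.finite_range fun i => w i / v i).bddBelow i

theorem le_maxRatio {n : ℕ} (w v : Fin n → ℝ) (i : Fin n) : w i / v i ≤ maxRatio w v :=
  le_ciSup (Set.finite_range fun i => w i / v i).bddAbove i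

theorem exists_minRatio_eq {n : ℕ} [NeZero n] (w v : Fin n → ℝ) :
    ∃ i, w i / v i = minRatio w v :=
  exists_eq_ciInf_of_finite (f := fun i => w i / v i)

/-- The invariant of the iteration: `x` is a positive unit vector with `B x ≤ lam x`. -/
structure IsPosSuper {n : ℕ} (B : Matrix (Fin n) (Fin n) ℝ)
    (x : EuclideanSpace ℝ (Fin n)) (lam : ℝ) : Prop where
  pos : ∀ i, 0 < x i
  norm_eq : ‖x‖ = 1
  le : ∀ i, (B *ᵥ x.ofLp) i ≤ lam * x i

theorem IsPosSuper.nonneg {n : ℕ} [NeZero n] {B : Matrix (Fin n) (Fin n) ℝ}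
    (hB : ∀ i j, 0 ≤ B i j) {x : EuclideanSpace ℝ (Fin n)} {lam : ℝ}
    (h : IsPosSuper B x lam) : 0 ≤ lam := by
  have h0 : 0 ≤ (B *ᵥ x.ofLp) 0 := by
    simp only [Matrix.mulVec, dotProduct]
    exact Finset.sum_nonneg fun j _ => mul_nonneg (hB 0 j) (h.pos j).le
  exact nonneg_of_mul_nonneg_left (h0.trans (h.le 0)) (h.pos 0)

/-- One step of the iteration keeps the invariant. The last part bounds the decrease of `lam`
from below and the residual `lam x' - B x'` from above, with `r = ‖y‖⁻¹` for the solution `y`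
of the inner system. -/
theorem INI1Step.isPosSuper {n : ℕ} [NeZero n] {B : Matrix (Fin n) (Fin n) ℝ}
    (hB : ∀ i j, 0 ≤ B i j) {γ : ℝ} (hγ0 : 0 < γ) (hγ1 : γ < 1)
    {x x' : EuclideanSpace ℝ (Fin n)} {lam lam' : ℝ} (hx : IsPosSuper B x lam)
    (hs : INI1Step B γ x lam x' lam') :
    IsPosSuper B x' lam' ∧ lam' < lam ∧ ∃ r > 0,
      (∀ δ > 0, (∀ i, δ ≤ x i) → (1 - γ) * δ * r ≤ lam - lam') ∧
      ∀ i, |lam * x' i - (B *ᵥ x'.ofLp) i| ≤ 2 * r := by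
  obtain ⟨y, f, hsol, hf, rfl, hlam⟩ := hs
  have hrow : ∀ i, lam * y i - (B *ᵥ y.ofLp) i = x i + f i := by
    intro i
    have := congrFun hsol i
    simpa [Matrix.sub_mulVec, Matrix.smul_mulVec] using this
  have hfi : ∀ i, |f i| ≤ γ * x i := fun i =>
    (PiLp.norm_apply_le f i).trans (hf.trans (mul_le_mul_of_nonneg_left (vmin_le _ i) hγ0.le))
  have hglb : ∀ i, (1 - γ) * x i ≤ x i + f i := fun i => by
    have := neg_le_of_abs_le (hfi i)
    linarith
  have hg : ∀ i, 0 < x i + f i := fun i =>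
    (mul_pos (sub_pos.2 hγ1) (hx.pos i)).trans_le (hglb i)
  have hy : ∀ i, 0 < y i := fun i =>
    pos_of_supersolution hB hx.pos hx.le (fun i => by have := hrow i; have := hg i; linarith) i
  have hny : 0 < ‖y‖ := by
    rw [norm_pos_iff]
    rintro rfl
    simpa using hy 0
  have hB' : ∀ i, (B *ᵥ (‖y‖⁻¹ • y).ofLp) i = ‖y‖⁻¹ * (B *ᵥ y.ofLp) i := fun i => by
    simp [Matrix.mulVec_smul]
  obtain ⟨m, hm⟩ := exists_minRatio_eq (x.ofLp + f.ofLp) y.ofLp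
  have hm' : lam - lam' = (x m + f m) / y m := by
    rw [hlam, ← hm]
    simp
  refine ⟨⟨fun i => ?_, ?_, fun i => ?_⟩, ?_, ‖y‖⁻¹, inv_pos.2 hny, fun δ hδ hδx => ?_, fun i => ?_⟩
  · exact mul_pos (inv_pos.2 hny) (hy i)
  · rw [norm_smul, norm_inv, norm_norm, inv_mul_cancel₀ hny.ne']
  · have h1 : minRatio (x.ofLp + f.ofLp) y.ofLp ≤ (x i + f i) / y i := minRatio_le _ _ i
    rw [le_div_iff₀ (hy i)] at h1
    have h2 : (B *ᵥ y.ofLp) i ≤ lam' * y i := by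
      have := hrow i
      rw [hlam, sub_mul]
      linarith
    rw [hB']
    calc ‖y‖⁻¹ * (B *ᵥ y.ofLp) i ≤ ‖y‖⁻¹ * (lam' * y i) :=
          mul_le_mul_of_nonneg_left h2 (inv_pos.2 hny).le
      _ = lam' * (‖y‖⁻¹ • y) i := by
        simp only [PiLp.smul_apply, smul_eq_mul]
        ring
  · have := div_pos (hg m) (hy m)
    linarith
  · rw [hm', ← div_eq_mul_inv]
    have hym : y m ≤ ‖y‖ := (le_abs_self _).trans (PiLp.norm_apply_le y m)
    have h1 : (1 - γ) * δ ≤ x m + f m :=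
      (mul_le_mul_of_nonneg_left (hδx m) (sub_pos.2 hγ1).le).trans (hglb m)
    exact div_le_div₀ (hg m).le h1 (hy m) hym
  · have h1 : x i ≤ 1 := hx.norm_eq ▸ (le_abs_self _).trans (PiLp.norm_apply_le x i)
    have h2 : x i + f i ≤ 2 := by
      have := le_of_abs_le (hfi i)
      nlinarith [hx.pos i]
    have h3 : lam * (‖y‖⁻¹ • y) i - (B *ᵥ (‖y‖⁻¹ • y).ofLp) i = (x i + f i) * ‖y‖⁻¹ := by
      rw [hB', ← hrow]
      simp only [PiLp.smul_apply, smul_eq_mul]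
      ring
    rw [h3, abs_of_pos (mul_pos (hg i) (inv_pos.2 hny))]
    exact mul_le_mul_of_nonneg_right h2 (inv_pos.2 hny).le

/-! ### Convergence of the iteration -/

theorem IsINI1.isPosSuper {n : ℕ} [NeZero n] {B : Matrix (Fin n) (Fin n) ℝ}
    (hB : ∀ i j, 0 ≤ B i j) {γ : ℝ} (hγ0 : 0 < γ) (hγ1 : γ < 1)
    {x : ℕ → EuclideanSpace ℝ (Fin n)} {lam : ℕ → ℝ} (h : IsINI1 B γ x lam) (k : ℕ) :
    IsPosSuper B (x k) (lam k) := by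
  induction k with
  | zero =>
    refine ⟨h.pos_zero, h.norm_zero, fun i => ?_⟩
    rw [← div_le_iff₀ (h.pos_zero i), h.lam_zero]
    exact le_maxRatio (B *ᵥ (x 0).ofLp) (x 0).ofLp i
  | succ k ih =>
    by_cases hk : IsExact B (x k) (lam k)
    · rw [(h.terminated k hk).1, (h.terminated k hk).2]
      exact ih
    · exact ((h.step k hk).isPosSuper hB hγ0 hγ1 ih).1

theorem IsINI1.eq_of_isExact {n : ℕ} {B : Matrix (Fin n) (Fin n) ℝ} {γ : ℝ}
    {x : ℕ → EuclideanSpace ℝ (Fin n)} {lam : ℕ → ℝ} (h : IsINI1 B γ x lam) {N : ℕ}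
    (hN : IsExact B (x N) (lam N)) (k : ℕ) (hk : N ≤ k) : x k = x N ∧ lam k = lam N := by
  induction k, hk using Nat.le_induction with
  | base => exact ⟨rfl, rfl⟩
  | succ k _ ih =>
    have := h.terminated k (by rw [ih.1, ih.2]; exact hN)
    exact ⟨this.1.trans ih.1, this.2.trans ih.2⟩

/-- If the iteration never terminates, the limit of the approximate eigenvalues has a positive
eigenvector, a limit point of the approximate eigenvectors. -/
theorem IsINI1.exists_pos_eigenvector {n : ℕ} [NeZero n] {B : Matrix (Fin n) (Fin n) ℝ}
    (hB : IsIrreducibleNonneg B) {γ : ℝ} (hγ0 : 0 < γ) (hγ1 : γ < 1)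
    {x : ℕ → EuclideanSpace ℝ (Fin n)} {lam : ℕ → ℝ} (h : IsINI1 B γ x lam)
    (hanti : Antitone lam) (hne : ∀ k, ¬ IsExact B (x k) (lam k)) {L : ℝ}
    (hL : Tendsto lam atTop (𝓝 L)) :
    ∃ v : Fin n → ℝ, (∀ i, 0 < v i) ∧ B *ᵥ v = L • v := by
  have hinv := h.isPosSuper hB.nonneg hγ0 hγ1
  obtain ⟨δ, hδ, hle⟩ := exists_uniform_pos hB (lam 0)
  have hδx : ∀ k i, δ ≤ x k i := fun k =>
    hle (x k) (hinv k).norm_eq (fun i => ((hinv k).pos i).le) fun i =>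
      ((hinv k).le i).trans
        (mul_le_mul_of_nonneg_right (hanti (Nat.zero_le k)) ((hinv k).pos i).le)
  have hstep := fun k => ((h.step k (hne k)).isPosSuper hB.nonneg hγ0 hγ1 (hinv k)).2.2
  choose r hr hdec hres using hstep
  have hc : 0 < (1 - γ) * δ := mul_pos (sub_pos.2 hγ1) hδ
  have hr0 : Tendsto r atTop (𝓝 0) := by
    have hd : Tendsto (fun k => (lam k - lam (k + 1)) / ((1 - γ) * δ)) atTop (𝓝 0) := by
      have := (hL.sub (hL.comp (tendsto_add_atTop_nat 1))).div_const ((1 - γ) * δ)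
      simpa using this
    refine squeeze_zero (fun k => (hr k).le) (fun k => ?_) hd
    rw [le_div_iff₀ hc, mul_comm]
    exact hdec k δ hδ (hδx k)
  obtain ⟨v, -, φ, hφ, hv⟩ := (isCompact_sphere (0 : EuclideanSpace ℝ (Fin n)) 1).tendsto_subseq
    (x := fun k => x (k + 1)) fun k => by simpa using (hinv (k + 1)).norm_eq
  have hvi : ∀ i, Tendsto (fun k => x (φ k + 1) i) atTop (𝓝 (v i)) := fun i =>
    ((by fun_prop : Continuous fun u : EuclideanSpace ℝ (Fin n) => u i).tendsto v).comp hv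
  refine ⟨v.ofLp, fun i => hδ.trans_le (ge_of_tendsto' (hvi i) fun k => hδx _ i), ?_⟩
  ext i
  have hBi : Tendsto (fun k => (B *ᵥ (x (φ k + 1)).ofLp) i) atTop (𝓝 ((B *ᵥ v.ofLp) i)) := by
    simp only [Matrix.mulVec, dotProduct]
    exact tendsto_finsetSum _ fun j _ => (hvi j).const_mul _
  have h1 := ((hL.comp hφ.tendsto_atTop).mul (hvi i)).sub hBi
  have h2 : Tendsto (fun k => lam (φ k) * x (φ k + 1) i - (B *ᵥ (x (φ k + 1)).ofLp) i)
      atTop (𝓝 0) := by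
    refine squeeze_zero_norm (fun k => hres (φ k) i) ?_
    simpa using (hr0.comp hφ.tendsto_atTop).const_mul 2
  have h3 := tendsto_nhds_unique h1 h2
  simp only [Pi.smul_apply, smul_eq_mul]
  linarith

end NodaIteration

theorem theorem1 {n : ℕ} (B : Matrix (Fin n) (Fin n) ℝ)
    (hB : NodaIteration.IsIrreducibleNonneg B)
    (γ : ℝ) (hγ0 : 0 < γ) (hγ1 : γ < 1)
    (x : ℕ → EuclideanSpace ℝ (Fin n)) (lam : ℕ → ℝ)
    (hrun : NodaIteration.IsINI1 B γ x lam) :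
    Antitone lam ∧
    (∀ k, ¬ NodaIteration.IsExact B (x k) (lam k) → lam (k + 1) < lam k) ∧
    Tendsto lam atTop (𝓝 (NodaIteration.rho B)) := by
  -- In dimension `0` there is no unit vector to start from.
  have : NeZero n := ⟨by
    rintro rfl
    have h1 := hrun.norm_zero
    rw [Subsingleton.elim (x 0) 0, norm_zero] at h1
    exact zero_ne_one h1⟩
  have hinv := hrun.isPosSuper hB.nonneg hγ0 hγ1
  have hstrict : ∀ k, ¬ NodaIteration.IsExact B (x k) (lam k) → lam (k + 1) < lam k := fun k hk =>
    ((hrun.step k hk).isPosSuper hB.nonneg hγ0 hγ1 (hinv k)).2.1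
  have hanti : Antitone lam := antitone_nat_of_succ_le fun k => by
    by_cases hk : NodaIteration.IsExact B (x k) (lam k)
    · exact (hrun.terminated k hk).2.le
    · exact (hstrict k hk).le
  refine ⟨hanti, hstrict, ?_⟩
  by_cases hex : ∃ N, NodaIteration.IsExact B (x N) (lam N)
  · obtain ⟨N, hN⟩ := hex
    rw [NodaIteration.rho_eq_of_pos_eigenvector hB.nonneg (hinv N).pos hN]
    exact tendsto_atTop_of_eventually_const fun k hk => (hrun.eq_of_isExact hN k hk).2
  · push Not at hex
    have hL := tendsto_atTop_ciInf hanti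
      ⟨0, by rintro _ ⟨k, rfl⟩; exact (hinv k).nonneg hB.nonneg⟩
    obtain ⟨v, hv, hev⟩ := hrun.exists_pos_eigenvector hB hγ0 hγ1 hanti hex hL
    rwa [NodaIteration.rho_eq_of_pos_eigenvector hB.nonneg hv hev]
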